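/- Let $D$ be an Archimedean, densely ordered, linearly ordered commutative ring (an interpolating lattice ring streak, for example $\mathbb{Q}$ or $\mathbb{R}$), regarded as a subring of $\mathbb{R}$ through its unique order embedding sending $1$ to $1$. Let $W$ be the inductively defined set of finite tuples $a=(a_i,\alpha_i)_{i<n}$ ($n\in\mathbb{N}$) with $a_i\in W$ and $\alpha_i\in D_{\ge 0}$ (starting from the empty tuple), with the distance defined recursively by $$d(a,b)=\sup\big(\{|d(a_i,b)-\alpha_i| : i<n\}\cup\{|d(a,b_j)-\beta_j| : j<m\}\big)$$ for $a=(a_i,\alpha_i)_{i<n}$, $b=(b_j,\beta_j)_{j<m}$, where $\sup\emptyset=0$. A tuple $a$ is permissible if every $a_i$ is permissible and $\alpha_i-\alpha_j\le d(a_i,a_j)\le\alpha_i+\alpha_j$ for all $i,j<n$. The set $V$ of permissible tuples is a pseudometric space with the distance $d$. Let $\mathbb{U}$ be the completion of $V$, with metric $d_{\mathbb{U}}$, write $[a]\in\mathbb{U}$ for the image of $a\in V$, and let $P$ be the set of all finite sequences $(x_i,\omega_i)_{i<n}$ in $\mathbb{U}\times\mathbb{R}_{\ge0}$ with $\omega_i-\omega_j\le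 d_{\mathbb{U}}(x_i,x_j)\le\omega_i+\omega_j$ for all $i,j<n$. Then $\mathbb{U}$ is a Urysohn space. Explicitly: 1. $\mathbb{U}$ is an inhabited complete metrically separable metric space: it is complete and there is a sequence $u:\mathbb{N}\to\mathbb{U}$ with dense image. 2. There is a map $E:P\to\mathbb{U}$ with $d_{\mathbb{U}}\big(E((x_i,\omega_i)_{i<n}),x_k\big)=\omega_k$ for all $(x_i,\omega_i)_{i<n}\in P$ and $k<n$. It can be chosen canonically: there is exactly one such $E$ for which, in addition, for every $(x_i,\omega_i)_{i<n}\in P$, every real $\varepsilon>0$ and every permissible tuple $a=(a_i,\alpha_i)_{i<n}\in V$ with $d_{\mathbb{U}}(x_i,[a_i])<\varepsilon/2$ and $|\alpha_i-\omega_i|<\varepsilon/2$ for all $i<n$, one has $d_{\mathbb{U}}\big(E((x_i,\omega_i)_{i<n}),[a]\big)\le\varepsilon$. 3. Let $E:P\to\mathbb{U}$ be any map as in the first sentence of 2. Let $(X,d_X)$ be a metric space with a given map $s:\mathbb{N}\to\mathbf{1}+X$ enumerating a metrically dense subset (for all $x\in X$ and $r>0$ there is $n$ with $s_n\in X$ and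 $d_X(x,s_n)<r$), let $F=\{y_0,\dots,y_{k-1}\}\subseteq X$ be a finite subset with a given enumeration (possibly empty or with repetitions), and let $e:F\to\mathbb{U}$ be an isometry. Then there is a canonical isometry $f:X\to\mathbb{U}$ with $f|_F=e$: there is exactly one isometry $f:X\to\mathbb{U}$ with $f|_F=e$ such that for every $n$ with $s_n\in X$ the concatenated sequence below belongs to $P$ and $$f(s_n)=E\Big(\big(e(y_i),d_X(s_n,y_i)\big)_{i<k}::\big(f(s_j),d_X(s_n,s_j)\big)_{j<n,\ s_j\in X}\Big).$$ -/

import Mathlib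

namespace Urysohn

/-- Formal tuples over an ordered ring `D`: given `n` formal tuples `a 0, …, a (n-1)` and
nonnegative elements `α 0, …, α (n-1)` of `D`, the sequence `(a i, α i)` is again a formal tuple.
It stands for a point at distance `α i` from `a i` for every `i`. -/
inductive Tuple (D : Type*) [Zero D] [LE D] : Type _
  | mk (n : ℕ) (a : Fin n → Tuple D) (α : Fin n → {x : D // 0 ≤ x}) : Tuple D

namespace Tuple

/-- The age of a tuple: `0` for the empty tuple, and otherwise one more than the largest age of its
predecessors. -/
def age {D : Type*} [Zero D] [LE D] : Tuple D → ℕ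
  | mk _ a _ => Finset.univ.sup fun i => age (a i) + 1

theorem age_lt {D : Type*} [Zero D] [LE D] {n : ℕ} (a : Fin n → Tuple D) (α : Fin n → {x : D // 0 ≤ x}) (i : Fin n) :
    age (a i) < age (mk n a α) := by
  rw [age]
  exact Nat.lt_of_succ_le (Finset.le_sup (f := fun i => age (a i) + 1) (Finset.mem_univ i))

variable {D : Type*} [CommRing D] [LinearOrder D] [IsStrictOrderedRing D]

/-- The distance of two formal tuples `a = (a i, α i)` and `b = (b j, β j)`: the supremum of all
`|d (a i, b) - α i|` and all `|d (a, b j) - β j|`, taken among the nonnegative elements of `D`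
(so that the empty supremum is `0`), by recursion on the sum of the ages. -/
def d : Tuple D → Tuple D → {x : D // 0 ≤ x}
  | mk n a α, mk m b β =>
    (Finset.univ.sup fun i : Fin n =>
        (⟨|(d (a i) (mk m b β) : D) - (α i : D)|, abs_nonneg _⟩ : {x : D // 0 ≤ x}))
      ⊔ (Finset.univ.sup fun j : Fin m =>
        (⟨|(d (mk n a α) (b j) : D) - (β j : D)|, abs_nonneg _⟩ : {x : D // 0 ≤ x}))
termination_by a b => age a + age b
decreasing_by
  · exact Nat.add_lt_add_right (age_lt a α i) _
  · exact Nat.add_lt_add_left (age_lt b β j) _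

/-- A tuple `(a i, α i)` is permissible when all its predecessors `a i` are permissible and the
`α i` respect the triangle inequalities `α i - α j ≤ d (a i, a j) ≤ α i + α j`. -/
def Permissible : Tuple D → Prop
  | mk _ a α => (∀ i, Permissible (a i)) ∧
      ∀ i j, (α i : D) - α j ≤ d (a i) (a j) ∧ (d (a i) (a j) : D) ≤ α i + α j

theorem d_le_iff {n m : ℕ} {a : Fin n → Tuple D} {α : Fin n → {x : D // 0 ≤ x}}
    {b : Fin m → Tuple D} {β : Fin m → {x : D // 0 ≤ x}} {r : D} (hr : 0 ≤ r) :
    (d (mk n a α) (mk m b β) : D) ≤ r ↔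
      (∀ i, |(d (a i) (mk m b β) : D) - α i| ≤ r) ∧
        ∀ j, |(d (mk n a α) (b j) : D) - β j| ≤ r := by
  have h : ((d (mk n a α) (mk m b β) : {x : D // 0 ≤ x}) : D) ≤ r ↔
      d (mk n a α) (mk m b β) ≤ (⟨r, hr⟩ : {x : D // 0 ≤ x}) := Iff.rfl
  rw [h, d, max_le_iff, Finset.sup_le_iff, Finset.sup_le_iff]
  simp only [Finset.mem_univ, true_imp_iff, ← Subtype.coe_le_coe]

theorem abs_left_le {n : ℕ} (a : Fin n → Tuple D) (α : Fin n → {x : D // 0 ≤ x}) (b : Tuple D)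
    (i : Fin n) : |(d (a i) b : D) - α i| ≤ d (mk n a α) b := by
  cases b with
  | mk m b β => exact ((d_le_iff (d (mk n a α) (mk m b β)).2).1 le_rfl).1 i

theorem abs_right_le {m : ℕ} (a : Tuple D) (b : Fin m → Tuple D) (β : Fin m → {x : D // 0 ≤ x})
    (j : Fin m) : |(d a (b j) : D) - β j| ≤ d a (mk m b β) := by
  cases a with
  | mk n a α => exact ((d_le_iff (d (mk n a α) (mk m b β)).2).1 le_rfl).2 j

theorem d_comm (a b : Tuple D) : d a b = d b a := by
  cases a with
  | mk n a α =>
    cases b with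
    | mk m b β =>
      rw [d, d, max_comm]
      congr 1
      · refine Finset.sup_congr rfl fun j _ => ?_
        simp only [d_comm (mk n a α) (b j)]
      · refine Finset.sup_congr rfl fun i _ => ?_
        simp only [d_comm (a i) (mk m b β)]
termination_by age a + age b
decreasing_by
  · subst_vars; exact Nat.add_lt_add_left (age_lt _ _ _) _
  · subst_vars; exact Nat.add_lt_add_right (age_lt _ _ _) _

theorem d_triangle (a b c : Tuple D) : (d a c : D) ≤ d a b + d b c := by
  cases a with
  | mk n a α =>
    cases c with
    | mk m c γ =>
      refine (d_le_iff (add_nonneg (d _ b).2 (d b _).2)).2 ⟨fun i => ?_, fun k => ?_⟩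
      · have h1 := abs_le.1 (abs_left_le a α b i)
        have h2 := d_triangle (a i) b (mk m c γ)
        have h3 := d_triangle (a i) (mk m c γ) b
        rw [d_comm (mk m c γ) b] at h3
        rw [abs_le]
        constructor <;> linarith [h1.1, h1.2]
      · have h1 := abs_le.1 (abs_right_le b c γ k)
        have h2 := d_triangle (mk n a α) b (c k)
        have h3 := d_triangle b (mk n a α) (c k)
        rw [d_comm b (mk n a α)] at h3
        rw [abs_le]
        constructor <;> linarith [h1.1, h1.2]
termination_by age a + age b + age c
decreasing_by
  all_goals subst_vars
  · have := age_lt a α i; omega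
  · have := age_lt a α i; omega
  · have := age_lt c γ k; omega
  · have := age_lt c γ k; omega

theorem Permissible.pred {n : ℕ} {a : Fin n → Tuple D} {α : Fin n → {x : D // 0 ≤ x}}
    (h : Permissible (mk n a α)) (i : Fin n) : Permissible (a i) := by
  rw [Permissible] at h
  exact h.1 i

/-- A permissible tuple is at distance `0` from itself, so `d` restricts to a pseudometric on
permissible tuples. -/
theorem d_self_of_permissible (a : Tuple D) (ha : Permissible a) : (d a a : D) = 0 := by
  induction hN : age a using Nat.strong_induction_on generalizing a with
  | _ N ih =>
    subst hN
    cases a with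
    | mk n a α =>
      have hd0 : ∀ b : Tuple D, Permissible b → age b < age (mk n a α) → (d b b : D) = 0 :=
        fun b hb hlt => ih _ hlt b hb rfl
      have key : ∀ (b : Tuple D) (i : Fin n), Permissible b → age b < age (mk n a α) →
          (d (mk n a α) b : D) ≤ α i + d (a i) b := by
        intro b i
        induction b with
        | mk m b β ihb =>
          intro hb hlt
          have hbb := hd0 _ hb hlt
          refine (d_le_iff (add_nonneg (α i).2 (d _ _).2)).2 ⟨fun k => ?_, fun j => ?_⟩
          · have hp := ha
            rw [Permissible] at hp
            have h1 := hp.2 k i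
            have h2 := d_triangle (a k) (a i) (mk m b β)
            have h3 := d_triangle (a k) (mk m b β) (a i)
            rw [d_comm (mk m b β) (a i)] at h3
            rw [abs_le]
            constructor <;> linarith [h1.1, h1.2]
          · have hlt' : age (b j) < age (mk n a α) := (age_lt b β j).trans hlt
            have h0 := hd0 _ (hb.pred j) hlt'
            have h1 := ihb j (hb.pred j) hlt'
            have h2 := d_triangle (a i) (mk m b β) (b j)
            have h3 := abs_le.1 (abs_left_le a α (b j) i)
            have h4 := d_triangle (mk m b β) (a i) (b j)
            rw [d_comm (mk m b β) (a i)] at h4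
            have h5 := abs_le.1 (abs_left_le b β (b j) j)
            have h6 := abs_le.1 (abs_right_le (mk m b β) b β j)
            rw [abs_le]
            constructor <;> linarith [h3.1, h3.2, h5.1, h5.2, h6.1, h6.2]
      have hpred : ∀ i, (d (mk n a α) (a i) : D) = α i := by
        intro i
        have h0 := hd0 _ (ha.pred i) (age_lt a α i)
        have h1 := key (a i) i (ha.pred i) (age_lt a α i)
        have h2 := abs_le.1 (abs_left_le a α (a i) i)
        apply le_antisymm <;> linarith [h2.1, h2.2]
      refine le_antisymm ((d_le_iff le_rfl).2 ⟨fun i => ?_, fun i => ?_⟩) (d _ _).2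
      · rw [d_comm, hpred, sub_self, abs_zero]
      · rw [hpred, sub_self, abs_zero]

end Tuple

/-- The set of permissible tuples over `D`. -/
def PermissibleTuple (D : Type*) [CommRing D] [LinearOrder D] [IsStrictOrderedRing D] : Type _ :=
  {a : Tuple D // a.Permissible}

namespace PermissibleTuple

/-- Permissible tuples form a pseudometric space. Distances in the Archimedean ordered ring `D` are
read as real numbers through the order embedding of `D` into `ℝ` which sends `1` to `1`. -/
noncomputable instance {D : Type*} [CommRing D] [LinearOrder D] [IsStrictOrderedRing D]
    [Archimedean D] : PseudoMetricSpace (PermissibleTuple D) where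
  dist a b := Archimedean.embedReal D (Tuple.d a.1 b.1 : D)
  dist_self a := by rw [Tuple.d_self_of_permissible a.1 a.2, map_zero]
  dist_comm a b := by rw [Tuple.d_comm]
  dist_triangle a b c := by
    rw [← map_add]
    exact (Archimedean.embedReal D).monotone' (Tuple.d_triangle a.1 b.1 c.1)

/-- The permissible tuple `(b i, α i)` made of permissible tuples `b i`. -/
def mk {D : Type*} [CommRing D] [LinearOrder D] [IsStrictOrderedRing D] {n : ℕ}
    (b : Fin n → PermissibleTuple D) (α : Fin n → {x : D // 0 ≤ x})
    (h : (Tuple.mk n (fun i => (b i).1) α).Permissible) : PermissibleTuple D :=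
  ⟨Tuple.mk n (fun i => (b i).1) α, h⟩

end PermissibleTuple

/-- The space `𝕌`: the (metric) completion of the pseudometric space of permissible tuples. -/
abbrev UrysohnSpace (D : Type*) [CommRing D] [LinearOrder D] [IsStrictOrderedRing D]
    [Archimedean D] : Type _ :=
  UniformSpace.Completion (PermissibleTuple D)

/-- The set `P` of permissible finite sequences `(x i, ω i)` of points of a metric space `U` and
nonnegative reals, i.e. those with `ω i - ω j ≤ d (x i, x j) ≤ ω i + ω j` for all `i`, `j`. -/
def PermissibleSeq (U : Type*) [MetricSpace U] : Type _ :=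
  {l : List (U × NNReal) // ∀ i j : Fin l.length,
    ((l.get i).2 : ℝ) - (l.get j).2 ≤ dist (l.get i).1 (l.get j).1 ∧
      dist (l.get i).1 (l.get j).1 ≤ ((l.get i).2 : ℝ) + (l.get j).2}

/-- `E` sends every permissible sequence `(x i, ω i)` to a point at distance `ω k` from `x k`, for
every `k`. -/
def Realizes {U : Type*} [MetricSpace U] (E : PermissibleSeq U → U) : Prop :=
  ∀ (p : PermissibleSeq U) (k : Fin p.1.length), dist (E p) (p.1.get k).1 = (p.1.get k).2

/-- `E (x i, ω i)` is the limit of those permissible tuples `(b i, β i)` of the same length whose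
entries approximate the `x i` and the `ω i`: if these approximations are better than `ε / 2`, then
the tuple is within `ε` of `E (x i, ω i)`. -/
def IsLimitOfTuples {D : Type*} [CommRing D] [LinearOrder D] [IsStrictOrderedRing D]
    [Archimedean D] (E : PermissibleSeq (UrysohnSpace D) → UrysohnSpace D) : Prop :=
  ∀ (p : PermissibleSeq (UrysohnSpace D)) (ε : ℝ), 0 < ε →
    ∀ (b : Fin p.1.length → PermissibleTuple D) (β : Fin p.1.length → {x : D // 0 ≤ x})
      (h : (Tuple.mk p.1.length (fun i => (b i).1) β).Permissible),
      (∀ i, dist (p.1.get i).1 (b i : UrysohnSpace D) < ε / 2 ∧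
        |Archimedean.embedReal D (β i : D) - (p.1.get i).2| < ε / 2) →
      dist (E p) (PermissibleTuple.mk b β h : UrysohnSpace D) ≤ ε

/-- `s : ℕ → 1 + X` enumerates a countable metrically dense subset of `X`. -/
def MetricallyDenseSeq {X : Type*} [MetricSpace X] (s : ℕ → Option X) : Prop :=
  ∀ (x : X) (r : ℝ), 0 < r → ∃ n z, s n = some z ∧ dist x z < r

/-- The finite sequence `(e (y i), d (x, y i))`, `i < k`, followed by the `(f (s j), d (x, s j))`
with `j < n` and `s j ∈ X`, in the order of the indices. -/
noncomputable def extensionSeq {X U : Type*} [MetricSpace X] (s : ℕ → Option X) {k : ℕ}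
    (y : Fin k → X) (e : Set.range y → U) (f : X → U) (n : ℕ) (x : X) : List (U × NNReal) :=
  (List.ofFn fun i => (e ⟨y i, Set.mem_range_self i⟩, nndist x (y i))) ++
    ((List.range n).filterMap s).map fun z => (f z, nndist x z)

/-- `f` is the extension of `e` obtained from `E` along the enumeration `s`, one point at a time:
whenever `s n = x` is a point of `X`, then `f x` is the value of `E` at the distances of `x` from
the points `y i` and from the previously enumerated points of `X`. -/
def BuiltFrom {X U : Type*} [MetricSpace X] [MetricSpace U] (E : PermissibleSeq U → U)
    (s : ℕ → Option X) {k : ℕ} (y : Fin k → X) (e : Set.range y → U) (f : X → U) : Prop :=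
  ∀ (n : ℕ) (x : X), s n = some x →
    ∃ p : PermissibleSeq U, p.1 = extensionSeq s y e f n x ∧ f x = E p

end Urysohn

namespace Urysohn

open Archimedean Set

/-! ### The order embedding of `D` into `ℝ`. -/

section Embedding

variable {D : Type*} [CommRing D] [LinearOrder D] [IsStrictOrderedRing D] [Archimedean D]

/-! A permissible tuple is itself a point of the space at the distances it prescribes: the term |d
(b i, b) - β i| is bounded by d (b, b) = 0 (`dist_mk_self`). Moreover, the point depends in a
Lipschitz way on its entries (`dist_mk_mk_le_of_entries`). Both facts pass to the completion once
every permissible sequence there is a limit of permissible tuples (`exists_approximates`):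
approximating tuples are Cauchy, their limit is `E p`, and the approximations force uniqueness. The
Lipschitz bound also gives separability, by induction on age.

For extensions, one point is added at a time. Distances from a new point to points already placed
form a permissible sequence by the triangle inequality, so `E` supplies its image
(`PartiallyBuilt.exists_succ`). The resulting isometry on a dense set extends by completeness. The
recursion determines all values on the enumerated points, hence everywhere by continuity. -/

theorem embedReal_strictMono : StrictMono (embedReal D) :=
  (embedReal D).monotone'.strictMono_of_injective (embedReal_injective D)

theorem embedReal_abs (x : D) : embedReal D |x| = |embedReal D x| := by
  have hm : Monotone (embedReal D) := (embedReal D).monotone'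
  rcases le_total 0 x with h | h
  · have h' := hm h
    rw [map_zero] at h'
    rw [abs_of_nonneg h, abs_of_nonneg h']
  · have h' := hm h
    rw [map_zero] at h'
    rw [abs_of_nonpos h, abs_of_nonpos h', map_neg]

theorem embedReal_nonneg (x : {x : D // 0 ≤ x}) : 0 ≤ embedReal D (x : D) := by
  have h := (embedReal D).monotone' x.2
  simpa using h

/-- The image of a densely ordered Archimedean ring is dense in `ℝ`. -/
theorem exists_embedReal_mem_Ioo [DenselyOrdered D] {a b : ℝ} (hab : a < b) :
    ∃ x : D, embedReal D x ∈ Ioo a b := by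
  have hd : Dense ((embedReal D : D →+ ℝ).range : Set ℝ) := by
    apply AddSubgroup.dense_of_no_min
    · intro h
      have h1 : embedReal D 1 ∈ (embedReal D : D →+ ℝ).range := ⟨1, rfl⟩
      rw [h, AddSubgroup.mem_bot, embedReal_one] at h1
      exact one_ne_zero h1
    · rintro ⟨_, ⟨⟨x, rfl⟩, hx⟩, hmin⟩
      have hx0 : 0 < x := by
        rw [← embedReal_strictMono.lt_iff_lt, map_zero]
        exact hx
      obtain ⟨y, hy0, hyx⟩ := exists_between hx0
      have h0 := embedReal_strictMono hy0
      rw [map_zero] at h0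
      exact (embedReal_strictMono hyx).not_ge (hmin ⟨⟨y, rfl⟩, h0⟩)
  obtain ⟨_, ⟨x, rfl⟩, hx⟩ := hd.exists_between hab
  exact ⟨x, hx⟩

end Embedding

/-! ### Tuples as points with prescribed distances; separability. -/

namespace PermissibleTuple

variable {D : Type*} [CommRing D] [LinearOrder D] [IsStrictOrderedRing D] [Archimedean D]

theorem dist_eq (a b : PermissibleTuple D) : dist a b = embedReal D (Tuple.d a.1 b.1 : D) := rfl

theorem dist_mk_self {n : ℕ} {b : Fin n → PermissibleTuple D} {β : Fin n → {x : D // 0 ≤ x}}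
    (h : (Tuple.mk n (fun i => (b i).1) β).Permissible) (i : Fin n) :
    dist (mk b β h) (b i) = embedReal D (β i : D) := by
  have h1 := Tuple.abs_left_le (fun i => (b i).1) β (mk b β h).1 i
  have h2 : (Tuple.d (Tuple.mk n (fun i => (b i).1) β) (mk b β h).1 : D) = 0 :=
    Tuple.d_self_of_permissible _ h
  rw [h2] at h1
  rw [dist_comm, dist_eq, sub_eq_zero.1 (abs_nonpos_iff.1 h1)]

/-- The distance of two tuples is bounded by any bound for its defining terms. -/
theorem dist_mk_mk_le {n m : ℕ} {a : Fin n → PermissibleTuple D} {α : Fin n → {x : D // 0 ≤ x}}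
    (ha : (Tuple.mk n (fun i => (a i).1) α).Permissible)
    {b : Fin m → PermissibleTuple D} {β : Fin m → {x : D // 0 ≤ x}}
    (hb : (Tuple.mk m (fun i => (b i).1) β).Permissible) {r : ℝ} (hr : 0 ≤ r)
    (h1 : ∀ i, |dist (a i) (mk b β hb) - embedReal D (α i : D)| ≤ r)
    (h2 : ∀ j, |dist (mk a α ha) (b j) - embedReal D (β j : D)| ≤ r) :
    dist (mk a α ha) (mk b β hb) ≤ r := by
  -- The bound `r` need not come from `D`, so `d_le_iff` is unavailable; the bound is carried
  -- through the finite suprema, the empty one being `0`.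
  have hbot : embedReal D ((⊥ : {x : D // 0 ≤ x}) : D) ≤ r := by
    have : ((⊥ : {x : D // 0 ≤ x}) : D) = 0 := rfl
    rw [this, map_zero]
    exact hr
  have hsup : ∀ x y : {x : D // 0 ≤ x}, embedReal D (x : D) ≤ r → embedReal D (y : D) ≤ r →
      embedReal D ((x ⊔ y : {x : D // 0 ≤ x}) : D) ≤ r := by
    intro x y hx hy
    rcases max_choice x y with h | h
    · exact (congrArg (fun t : {x : D // 0 ≤ x} => embedReal D (t : D)) h).trans_le hx
    · exact (congrArg (fun t : {x : D // 0 ≤ x} => embedReal D (t : D)) h).trans_le hy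
  change embedReal D (Tuple.d (Tuple.mk n (fun i => (a i).1) α)
    (Tuple.mk m (fun i => (b i).1) β) : D) ≤ r
  rw [Tuple.d]
  refine hsup _ _ ?_ ?_
  · refine Finset.sup_induction (p := fun t : {x : D // 0 ≤ x} => embedReal D (t : D) ≤ r)
      hbot (fun x hx y hy => hsup x y hx hy) fun i _ => ?_
    simp only [embedReal_abs, map_sub]
    exact h1 i
  · refine Finset.sup_induction (p := fun t : {x : D // 0 ≤ x} => embedReal D (t : D) ≤ r)
      hbot (fun x hx y hy => hsup x y hx hy) fun i _ => ?_
    simp only [embedReal_abs, map_sub]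
    exact h2 i

/-- Tuples of the same length with nearby entries are near to each other. -/
theorem dist_mk_mk_le_of_entries {n : ℕ} {a b : Fin n → PermissibleTuple D}
    {α β : Fin n → {x : D // 0 ≤ x}}
    (ha : (Tuple.mk n (fun i => (a i).1) α).Permissible)
    (hb : (Tuple.mk n (fun i => (b i).1) β).Permissible) {r : ℝ} (hr : 0 ≤ r)
    (h : ∀ i, dist (a i) (b i) + |embedReal D (α i : D) - embedReal D (β i : D)| ≤ r) :
    dist (mk a α ha) (mk b β hb) ≤ r := by
  refine dist_mk_mk_le ha hb hr (fun i => ?_) fun i => ?_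
  · have h0 := dist_mk_self hb i
    have h1 := dist_triangle (a i) (b i) (mk b β hb)
    have h2 := dist_triangle (b i) (a i) (mk b β hb)
    rw [dist_comm (b i) (a i)] at h2
    rw [dist_comm] at h0
    have h3 := h i
    have h4 := neg_abs_le (embedReal D (α i : D) - embedReal D (β i : D))
    have h5 := le_abs_self (embedReal D (α i : D) - embedReal D (β i : D))
    rw [abs_le]
    constructor <;> linarith
  · have h0 := dist_mk_self ha i
    have h1 := dist_triangle (mk a α ha) (a i) (b i)
    have h2 := dist_triangle (mk a α ha) (b i) (a i)
    rw [dist_comm (b i) (a i)] at h2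
    have h3 := h i
    have h4 := neg_abs_le (embedReal D (α i : D) - embedReal D (β i : D))
    have h5 := le_abs_self (embedReal D (α i : D) - embedReal D (β i : D))
    rw [abs_le]
    constructor <;> linarith

/-- Tuples of length `m` and age at most `n` are Lipschitz images of subsets of (tuples of age below
`n`)^m × ℝ^m, and there are countably many lengths. Weights are recorded as reals to have a
separable metric parameter space. -/
theorem isSeparable_setOf_age_lt (n : ℕ) :
    TopologicalSpace.IsSeparable {a : PermissibleTuple D | a.1.age < n} := by
  induction n with
  | zero => simpa using countable_empty.isSeparable
  | succ n ih =>
    let T (m : ℕ) : Set ((Fin m → PermissibleTuple D) × (Fin m → ℝ)) :=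
      {p | (∀ i, (p.1 i).1.age < n) ∧ ∃ β : Fin m → {x : D // 0 ≤ x},
        (Tuple.mk m (fun i => (p.1 i).1) β).Permissible ∧ ∀ i, embedReal D (β i : D) = p.2 i}
    have hT (m : ℕ) : TopologicalSpace.IsSeparable (T m) := by
      refine ((TopologicalSpace.isSeparable_pi fun _ : Fin m => ih).prod
        (TopologicalSpace.IsSeparable.of_separableSpace univ)).mono ?_
      exact fun p hp => ⟨fun i => hp.1 i, mem_univ _⟩
    choose β hβ hβe using fun (m : ℕ) (p : T m) => p.2.2
    let G (m : ℕ) (p : T m) : PermissibleTuple D := mk p.1.1 (β m p) (hβ m p)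
    -- The constant 2 counts one contribution from the points and one from the weights.
    have hG (m : ℕ) : LipschitzWith 2 (G m) := by
      refine LipschitzWith.of_dist_le_mul fun p q => ?_
      refine dist_mk_mk_le_of_entries _ _ (by positivity) fun i => ?_
      rw [hβe, hβe, ← Real.dist_eq]
      have h1 : dist (p.1.1 i) (q.1.1 i) ≤ dist p q :=
        (dist_le_pi_dist p.1.1 q.1.1 i).trans (le_max_left _ _)
      have h2 : dist (p.1.2 i) (q.1.2 i) ≤ dist p q :=
        (dist_le_pi_dist p.1.2 q.1.2 i).trans (le_max_right _ _)
      push_cast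
      linarith
    have hR (m : ℕ) : TopologicalSpace.IsSeparable (range (G m)) :=
      haveI := (hT m).separableSpace
      TopologicalSpace.isSeparable_range (hG m).continuous
    refine (TopologicalSpace.IsSeparable.iUnion hR).mono ?_
    rintro ⟨⟨m, a, α⟩, h⟩ hlt
    let b : Fin m → PermissibleTuple D := fun i => ⟨a i, h.pred i⟩
    have hp : (b, fun i => embedReal D (α i : D)) ∈ T m :=
      ⟨fun i => (Tuple.age_lt a α i).trans_le (Nat.lt_succ_iff.1 hlt), α, h, fun i => rfl⟩
    refine mem_iUnion.2 ⟨m, ⟨_, hp⟩, ?_⟩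
    have hα : β m ⟨_, hp⟩ = α :=
      funext fun i => Subtype.ext (embedReal_injective D (hβe m ⟨_, hp⟩ i))
    apply Subtype.ext
    change Tuple.mk m (fun i => (b i).1) (β m ⟨_, hp⟩) = _
    rw [hα]

instance : TopologicalSpace.SeparableSpace (PermissibleTuple D) := by
  rw [← TopologicalSpace.isSeparable_univ_iff]
  refine (TopologicalSpace.IsSeparable.iUnion fun n => isSeparable_setOf_age_lt n).mono ?_
  exact fun a _ => mem_iUnion.2 ⟨a.1.age + 1, Nat.lt_succ_self _⟩

instance : Nonempty (PermissibleTuple D) :=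
  ⟨mk Fin.elim0 Fin.elim0 (by
    rw [Tuple.Permissible]
    exact ⟨fun i => i.elim0, fun i => i.elim0⟩)⟩

end PermissibleTuple

/-! ### Realizing permissible sequences in the completion. -/

section Realization

variable {D : Type*} [CommRing D] [LinearOrder D] [IsStrictOrderedRing D] [Archimedean D]

/-- The permissible tuple `(b i, β i)` approximates the sequence `p` to within `r`. -/
def Approximates (p : PermissibleSeq (UrysohnSpace D)) (r : ℝ)
    (b : Fin p.1.length → PermissibleTuple D) (β : Fin p.1.length → {x : D // 0 ≤ x}) : Prop :=
  ∀ i, dist (p.1.get i).1 (b i : UrysohnSpace D) < r ∧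
    |embedReal D (β i : D) - (p.1.get i).2| < r

/-- Compared through `p`, both the points and the weights differ by at most `r + r'`, whence the
factor 2. -/
theorem Approximates.dist_mk_mk_le {p : PermissibleSeq (UrysohnSpace D)} {r r' : ℝ}
    {b b' : Fin p.1.length → PermissibleTuple D} {β β' : Fin p.1.length → {x : D // 0 ≤ x}}
    (h : Approximates p r b β) (h' : Approximates p r' b' β') (hr : 0 ≤ r) (hr' : 0 ≤ r')
    (hb : (Tuple.mk p.1.length (fun i => (b i).1) β).Permissible)
    (hb' : (Tuple.mk p.1.length (fun i => (b' i).1) β').Permissible) :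
    dist (PermissibleTuple.mk b β hb : UrysohnSpace D) (PermissibleTuple.mk b' β' hb') ≤
      2 * (r + r') := by
  rw [UniformSpace.Completion.dist_eq]
  refine PermissibleTuple.dist_mk_mk_le_of_entries hb hb' (by positivity) fun i => ?_
  have h1 := dist_triangle_left (b i : UrysohnSpace D) (b' i) (p.1.get i).1
  rw [UniformSpace.Completion.dist_eq] at h1
  have h2 := abs_sub_le (embedReal D (β i : D)) (p.1.get i).2 (embedReal D (β' i : D))
  rw [abs_sub_comm ((p.1.get i).2 : ℝ)] at h2
  linarith [(h i).1, (h i).2, (h' i).1, (h' i).2]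

/-- Nearby entries may violate the inequalities slightly. The weights are first raised, giving slack
for the upper bounds, and then replaced by the lower envelope min_j (w j + d (b j, b i)). This is
1-Lipschitz in `b i`, so the lower bounds hold exactly. -/
theorem exists_approximates [DenselyOrdered D] (p : PermissibleSeq (UrysohnSpace D)) {ε : ℝ}
    (hε : 0 < ε) : ∃ (b : Fin p.1.length → PermissibleTuple D)
      (β : Fin p.1.length → {x : D // 0 ≤ x}),
      (Tuple.mk p.1.length (fun i => (b i).1) β).Permissible ∧ Approximates p ε b β := by
  obtain ⟨δ, hδ, rfl⟩ : ∃ δ, 0 < δ ∧ ε = 8 * δ := ⟨ε / 8, by positivity, by ring⟩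
  have hb (i : Fin p.1.length) : ∃ b : PermissibleTuple D,
      dist (p.1.get i).1 (b : UrysohnSpace D) < δ :=
    UniformSpace.Completion.denseRange_coe.exists_dist_lt _ hδ
  choose b hb using hb
  have hdist (i j : Fin p.1.length) :
      |embedReal D (Tuple.d (b i).1 (b j).1 : D) - dist (p.1.get i).1 (p.1.get j).1| ≤ 2 * δ := by
    rw [← PermissibleTuple.dist_eq, ← UniformSpace.Completion.dist_eq, ← Real.dist_eq]
    refine (dist_dist_dist_le _ _ _ _).trans ?_
    rw [dist_comm, dist_comm (b j : UrysohnSpace D)]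
    linarith [hb i, hb j]
  -- Replacing points changes distances by at most 2δ. A raise of 4δ therefore leaves the envelope
  -- more than 2δ above the original weight, more than enough for the upper bounds.
  have hw (i : Fin p.1.length) : ∃ x : D,
      embedReal D x ∈ Ioo ((p.1.get i).2 + 4 * δ) ((p.1.get i).2 + 5 * δ) :=
    exists_embedReal_mem_Ioo (by linarith)
  choose w hw using hw
  have hmin (i : Fin p.1.length) : ∃ j, ∀ k,
      w j + (Tuple.d (b j).1 (b i).1 : D) ≤ w k + (Tuple.d (b k).1 (b i).1 : D) :=
    haveI : Nonempty (Fin p.1.length) := ⟨i⟩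
    Finite.exists_min _
  choose m hm using hmin
  have hlow (i : Fin p.1.length) :
      (p.1.get i).2 + 2 * δ < embedReal D (w (m i) + (Tuple.d (b (m i)).1 (b i).1 : D)) := by
    rw [map_add]
    linarith [(hw (m i)).1, (abs_le.1 (hdist (m i) i)).1, (p.2 i (m i)).1,
      dist_comm (p.1.get i).1 (p.1.get (m i)).1]
  have hup (i : Fin p.1.length) :
      embedReal D (w (m i) + (Tuple.d (b (m i)).1 (b i).1 : D)) < (p.1.get i).2 + 5 * δ := by
    have h := hm i i
    rw [Tuple.d_self_of_permissible _ (b i).2, add_zero] at h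
    exact ((embedReal D).monotone' h).trans_lt (hw i).2
  have hnonneg (i : Fin p.1.length) : 0 ≤ w (m i) + (Tuple.d (b (m i)).1 (b i).1 : D) := by
    rw [← embedReal_strictMono.le_iff_le, map_zero]
    linarith [hlow i, (p.1.get i).2.2]
  refine ⟨b, fun i => ⟨_, hnonneg i⟩, ?_, fun i => ⟨by linarith [hb i], ?_⟩⟩
  · rw [Tuple.Permissible]
    refine ⟨fun i => (b i).2, fun i j => ⟨?_, ?_⟩⟩
    · have h1 := hm i (m j)
      have h2 := Tuple.d_triangle (b (m j)).1 (b j).1 (b i).1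
      rw [Tuple.d_comm (b j).1] at h2
      change w (m i) + (Tuple.d (b (m i)).1 (b i).1 : D) -
        (w (m j) + (Tuple.d (b (m j)).1 (b j).1 : D)) ≤ _
      linarith
    · rw [← embedReal_strictMono.le_iff_le, map_add]
      linarith [hlow i, hlow j, (p.2 i j).2, (abs_le.1 (hdist i j)).2]
  · rw [abs_lt]
    constructor <;> linarith [hlow i, hup i]

theorem IsLimitOfTuples.realizes [DenselyOrdered D]
    {E : PermissibleSeq (UrysohnSpace D) → UrysohnSpace D} (hE : IsLimitOfTuples E) :
    Realizes E := by
  intro p k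
  refine eq_of_abs_sub_nonpos (le_of_forall_pos_le_add fun ε hε => ?_)
  -- Error budget: ε/2 for replacing `E p` by the tuple, ε/4 for the point, ε/4 for the weight.
  obtain ⟨b, β, h, hb⟩ := exists_approximates p (ε := ε / 4) (by positivity)
  have h1 := hE p (ε / 2) (by positivity) b β h fun i => by
    rw [show ε / 2 / 2 = ε / 4 by ring]
    exact hb i
  have h2 := PermissibleTuple.dist_mk_self h k
  rw [← UniformSpace.Completion.dist_eq] at h2
  have h3 := (abs_le.1 (Real.dist_eq _ _ ▸ dist_dist_dist_le (E p) (p.1.get k).1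
    (PermissibleTuple.mk b β h : UrysohnSpace D) (b k)))
  have h4 := abs_lt.1 (hb k).2
  rw [abs_le]
  constructor <;> linarith [(hb k).1]

theorem IsLimitOfTuples.eq [DenselyOrdered D]
    {E E' : PermissibleSeq (UrysohnSpace D) → UrysohnSpace D} (hE : IsLimitOfTuples E)
    (hE' : IsLimitOfTuples E') : E = E' := by
  funext p
  refine eq_of_forall_dist_le fun ε hε => ?_
  obtain ⟨b, β, h, hb⟩ := exists_approximates p (ε := ε / 2 / 2) (by positivity)
  have h1 := hE p (ε / 2) (by positivity) b β h hb
  have h2 := hE' p (ε / 2) (by positivity) b β h hb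
  linarith [dist_triangle_right (E p) (E' p) (PermissibleTuple.mk b β h : UrysohnSpace D)]

theorem exists_isLimitOfTuples [DenselyOrdered D] :
    ∃ E : PermissibleSeq (UrysohnSpace D) → UrysohnSpace D, IsLimitOfTuples E := by
  suffices H : ∀ p : PermissibleSeq (UrysohnSpace D), ∃ z : UrysohnSpace D, ∀ ε : ℝ, 0 < ε →
      ∀ (b : Fin p.1.length → PermissibleTuple D) (β : Fin p.1.length → {x : D // 0 ≤ x})
        (h : (Tuple.mk p.1.length (fun i => (b i).1) β).Permissible),
        Approximates p (ε / 2) b β →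
          dist z (PermissibleTuple.mk b β h : UrysohnSpace D) ≤ ε by
    choose E hE using H
    exact ⟨E, hE⟩
  intro p
  choose b β h hb using fun n : ℕ =>
    exists_approximates p (ε := 1 / ((n : ℝ) + 1)) Nat.one_div_pos_of_nat
  have hlim : Filter.Tendsto (fun n : ℕ => 1 / ((n : ℝ) + 1)) Filter.atTop (nhds 0) :=
    tendsto_one_div_add_atTop_nhds_zero_nat
  have hpos (n : ℕ) : 0 ≤ 1 / ((n : ℝ) + 1) := by positivity
  have hc : CauchySeq fun n => (PermissibleTuple.mk (b n) (β n) (h n) : UrysohnSpace D) := by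
    refine cauchySeq_of_le_tendsto_0 (fun n : ℕ => 2 * (1 / ((n : ℝ) + 1) + 1 / ((n : ℝ) + 1)))
      (fun n m N hn hm => ?_) (by simpa using (hlim.add hlim).const_mul 2)
    refine ((hb n).dist_mk_mk_le (hb m) (hpos n) (hpos m) (h n) (h m)).trans ?_
    have h1 := Nat.one_div_le_one_div (α := ℝ) hn
    have h2 := Nat.one_div_le_one_div (α := ℝ) hm
    linarith
  obtain ⟨z, hz⟩ := cauchySeq_tendsto_of_complete hc
  refine ⟨z, fun ε hε b' β' h' hb' => ?_⟩
  -- As the first tolerance tends to 0, the bound 2(r + ε/2) tends to exactly ε.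
  have hl : Filter.Tendsto (fun n : ℕ => 2 * (1 / ((n : ℝ) + 1) + ε / 2)) Filter.atTop
      (nhds ε) := by
    have := (hlim.add_const (ε / 2)).const_mul 2
    rwa [zero_add, mul_div_cancel₀ ε two_ne_zero] at this
  exact le_of_tendsto_of_tendsto' (hz.dist tendsto_const_nhds) hl fun n =>
    (hb n).dist_mk_mk_le hb' (hpos n) (by positivity) (h n) h'

end Realization

/-! ### Extending isometries one point at a time. -/

section Extension

/-- The points `y i` and the points enumerated by `s` before the index `n`. -/
def enumerated {X : Type*} (s : ℕ → Option X) {k : ℕ} (y : Fin k → X) (n : ℕ) : Set X :=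
  range y ∪ {x | ∃ j < n, s j = some x}

theorem enumerated_mono {X : Type*} (s : ℕ → Option X) {k : ℕ} (y : Fin k → X) :
    Monotone (enumerated s y) :=
  fun _ _ h => union_subset_union_right _ fun _ ⟨j, hj, hx⟩ => ⟨j, hj.trans_le h, hx⟩

/-- Lets the equations involving `E` be transferred between successive approximations of the
extension, and drives its uniqueness. -/
theorem extensionSeq_congr {X U : Type*} [MetricSpace X] {s : ℕ → Option X} {k : ℕ}
    {y : Fin k → X} {e : range y → U}
    {f g : X → U} {n : ℕ} (h : ∀ j < n, ∀ z, s j = some z → f z = g z) (x : X) :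
    extensionSeq s y e f n x = extensionSeq s y e g n x := by
  unfold extensionSeq
  congr 1
  refine List.map_congr_left fun z hz => ?_
  obtain ⟨j, hj, hjz⟩ := List.mem_filterMap.1 hz
  rw [h j (List.mem_range.1 hj) z hjz]

theorem mem_extensionSeq {X U : Type*} [MetricSpace X] {s : ℕ → Option X} {k : ℕ}
    {y : Fin k → X} {e : range y → U}
    {f : X → U} (hf : ∀ z : range y, f z = e z) {n : ℕ} {x : X} {q : U × NNReal} :
    q ∈ extensionSeq s y e f n x ↔ ∃ z ∈ enumerated s y n, (f z, nndist x z) = q := by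
  rw [extensionSeq, List.mem_append, List.mem_ofFn, List.mem_map]
  constructor
  · rintro (⟨i, rfl⟩ | ⟨z, hz, rfl⟩)
    · exact ⟨y i, Or.inl (mem_range_self i), by rw [← hf]⟩
    · obtain ⟨j, hj, hjz⟩ := List.mem_filterMap.1 hz
      exact ⟨z, Or.inr ⟨j, List.mem_range.1 hj, hjz⟩, rfl⟩
  · rintro ⟨z, ⟨i, rfl⟩ | ⟨j, hj, hjz⟩, rfl⟩
    · exact Or.inl ⟨i, by rw [← hf]⟩
    · exact Or.inr ⟨z, List.mem_filterMap.2 ⟨j, List.mem_range.2 hj, hjz⟩, rfl⟩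

variable {X U : Type*} [MetricSpace X] [MetricSpace U]

theorem exists_isometry_eqOn_of_dense [CompleteSpace U] {A : Set X} (hA : Dense A) {g : X → U}
    (hg : ∀ x ∈ A, ∀ y ∈ A, dist (g x) (g y) = dist x y) :
    ∃ f : X → U, Isometry f ∧ EqOn f g A := by
  have hi : Isometry fun x : A => g x := Isometry.of_dist_eq fun x y => hg x x.2 y y.2
  have hu := hi.uniformContinuous
  have hf : ∀ x : A, hA.extend (fun x : A => g x) x = g x := hA.extend_of_ind hu
  have hc : Continuous (hA.extend fun x : A => g x) := (hA.uniformContinuous_extend hu).continuous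
  refine ⟨hA.extend fun x : A => g x, Isometry.of_dist_eq fun x y => ?_, fun x hx => hf ⟨x, hx⟩⟩
  refine hA.denseRange_val.induction_on₂ (p := fun x y => dist (hA.extend (fun x : A => g x) x)
    (hA.extend (fun x : A => g x) y) = dist x y) ?_ (fun a b => ?_) x y
  · exact isClosed_eq ((hc.comp continuous_fst).dist (hc.comp continuous_snd)) continuous_dist
  · rw [hf, hf, hg a a.2 b b.2]

/-- `f` is an extension of `e` obtained from `E`, as far as the indices below `n` are concerned. -/
structure PartiallyBuilt (E : PermissibleSeq U → U) (s : ℕ → Option X) {k : ℕ} (y : Fin k → X)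
    (e : range y → U) (n : ℕ) (f : X → U) : Prop where
  dist_eq : ∀ x ∈ enumerated s y n, ∀ z ∈ enumerated s y n, dist (f x) (f z) = dist x z
  extends_e : ∀ z : range y, f z = e z
  eq_E : ∀ j < n, ∀ x, s j = some x →
    ∃ p : PermissibleSeq U, p.1 = extensionSeq s y e f j x ∧ f x = E p

variable {E : PermissibleSeq U → U} {s : ℕ → Option X} {k : ℕ} {y : Fin k → X} {e : range y → U}

theorem PartiallyBuilt.exists_succ (hE : Realizes E) {n : ℕ} {f : X → U}
    (hf : PartiallyBuilt E s y e n f) :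
    ∃ g, PartiallyBuilt E s y e (n + 1) g ∧ EqOn g f (enumerated s y n) := by
  cases hs : s n with
  | none =>
    have hA : enumerated s y (n + 1) = enumerated s y n := by
      refine subset_antisymm ?_ (enumerated_mono s y n.le_succ)
      rintro x (hx | ⟨j, hj, hx⟩)
      · exact Or.inl hx
      · rcases Nat.lt_succ_iff_lt_or_eq.1 hj with hj | rfl
        · exact Or.inr ⟨j, hj, hx⟩
        · simp [hs] at hx
    refine ⟨f, ⟨hA ▸ hf.dist_eq, hf.extends_e, fun j hj x hx => ?_⟩, fun _ _ => rfl⟩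
    rcases Nat.lt_succ_iff_lt_or_eq.1 hj with hj | rfl
    · exact hf.eq_E j hj x hx
    · simp [hs] at hx
  | some x =>
    have hA : enumerated s y (n + 1) ⊆ insert x (enumerated s y n) := by
      rintro z (hz | ⟨j, hj, hz⟩)
      · exact Or.inr (Or.inl hz)
      · rcases Nat.lt_succ_iff_lt_or_eq.1 hj with hj | rfl
        · exact Or.inr (Or.inr ⟨j, hj, hz⟩)
        · exact Or.inl (Option.some_injective _ (hz.symm.trans hs))
    have hp : ∀ i j : Fin (extensionSeq s y e f n x).length,
        (((extensionSeq s y e f n x).get i).2 : ℝ) - ((extensionSeq s y e f n x).get j).2 ≤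
          dist ((extensionSeq s y e f n x).get i).1 ((extensionSeq s y e f n x).get j).1 ∧
        dist ((extensionSeq s y e f n x).get i).1 ((extensionSeq s y e f n x).get j).1 ≤
          (((extensionSeq s y e f n x).get i).2 : ℝ) + ((extensionSeq s y e f n x).get j).2 := by
      intro i j
      obtain ⟨z, hz, hzi⟩ := (mem_extensionSeq hf.extends_e).1 (List.get_mem _ i)
      obtain ⟨z', hz', hzj⟩ := (mem_extensionSeq hf.extends_e).1 (List.get_mem _ j)
      rw [← hzi, ← hzj]
      simp only [coe_nndist, hf.dist_eq z hz z' hz']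
      constructor
      · linarith [dist_triangle_right x z z']
      · exact dist_triangle_left z z' x
    let p : PermissibleSeq U := ⟨_, hp⟩
    have hEp : ∀ z ∈ enumerated s y n, dist (E p) (f z) = dist x z := by
      intro z hz
      obtain ⟨i, hi⟩ := List.mem_iff_get.1
        ((mem_extensionSeq (x := x) hf.extends_e).2 ⟨z, hz, rfl⟩)
      have h := hE p i
      have hi' : p.1.get i = (f z, nndist x z) := hi
      rw [hi'] at h
      exact h
    classical
    let g := Function.update f x (E p)
    have hgx : g x = E p := Function.update_self ..
    have hgf : EqOn g f (enumerated s y n) := by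
      intro z hz
      -- If `x` was already placed, `E p` is at distance 0 from `f x`, so repetitions in the
      -- enumeration do no harm.
      by_cases hzx : z = x
      · subst hzx
        rw [hgx]
        exact dist_eq_zero.1 ((hEp z hz).trans (dist_self z))
      · exact Function.update_of_ne hzx ..
    have hcongr : ∀ j ≤ n, ∀ z, extensionSeq s y e f j z = extensionSeq s y e g j z := by
      intro j hj z
      exact extensionSeq_congr
        (fun i hi w hw => (hgf (Or.inr ⟨i, hi.trans_le hj, hw⟩)).symm) z
    refine ⟨g, ⟨?_, fun z => ?_, fun j hj z hz => ?_⟩, hgf⟩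
    · intro a ha b hb
      rcases hA ha with rfl | ha <;> rcases hA hb with rfl | hb
      · simp
      · rw [hgx, hgf hb, hEp b hb]
      · rw [hgx, hgf ha, dist_comm, hEp a ha, dist_comm]
      · rw [hgf ha, hgf hb, hf.dist_eq a ha b hb]
    · rw [hgf (Or.inl z.2), hf.extends_e]
    · rcases Nat.lt_succ_iff_lt_or_eq.1 hj with hj | rfl
      · obtain ⟨q, hq, hfq⟩ := hf.eq_E j hj z hz
        exact ⟨q, hq.trans (hcongr j hj.le z), (hgf (Or.inr ⟨j, hj, hz⟩)).trans hfq⟩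
      · obtain rfl : x = z := Option.some_injective _ (hs.symm.trans hz)
        exact ⟨p, hcongr j le_rfl x, hgx⟩

theorem exists_builtFrom [CompleteSpace U] [Nonempty U] (hE : Realizes E)
    (hs : MetricallyDenseSeq s) (he : Isometry e) :
    ∃ f : X → U, Isometry f ∧ (∀ z : range y, f z = e z) ∧ BuiltFrom E s y e f := by
  classical
  -- Values off the enumerated points are irrelevant placeholders; `PartiallyBuilt` does not
  -- constrain them.
  let f₀ : X → U := fun x => if h : x ∈ range y then e ⟨x, h⟩ else Classical.arbitrary U
  have hf₀ : ∀ z : range y, f₀ z = e z := fun z => dif_pos z.2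
  have h₀ : PartiallyBuilt E s y e 0 f₀ := by
    refine ⟨?_, hf₀, fun j hj => absurd hj j.not_lt_zero⟩
    have hsub : enumerated s y 0 ⊆ range y := by
      rintro x (hx | ⟨j, hj, -⟩)
      · exact hx
      · exact absurd hj j.not_lt_zero
    intro x hx z hz
    rw [hf₀ ⟨x, hsub hx⟩, hf₀ ⟨z, hsub hz⟩, he.dist_eq]
    rfl
  choose G hG hGf using fun (n : ℕ) (f : {f : X → U // PartiallyBuilt E s y e n f}) =>
    f.2.exists_succ hE
  let F : ∀ n, {f : X → U // PartiallyBuilt E s y e n f} :=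
    fun n => Nat.rec ⟨f₀, h₀⟩ (fun n f => ⟨G n f, hG n f⟩) n
  have hF : ∀ m n, m ≤ n → EqOn (F n).1 (F m).1 (enumerated s y m) := by
    intro m n hmn
    induction n, hmn using Nat.le_induction with
    | base => exact fun _ _ => rfl
    | succ n hmn ih =>
      exact fun x hx => (hGf n (F n) (enumerated_mono s y hmn hx)).trans (ih hx)
  let g : X → U := fun x =>
    if h : ∃ n, x ∈ enumerated s y n then (F h.choose).1 x else Classical.arbitrary U
  have hg : ∀ n, EqOn g (F n).1 (enumerated s y n) := by
    intro n x hx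
    have h : ∃ n, x ∈ enumerated s y n := ⟨n, hx⟩
    rw [show g x = (F h.choose).1 x from dif_pos h]
    exact (hF _ _ (le_max_left _ n) h.choose_spec).symm.trans (hF _ _ (le_max_right _ _) hx)
  have hdense : Dense (⋃ n, enumerated s y n) := by
    refine Metric.dense_iff.2 fun x r hr => ?_
    obtain ⟨n, z, hz, hxz⟩ := hs x r hr
    exact ⟨z, Metric.mem_ball'.2 hxz, mem_iUnion.2 ⟨n + 1, Or.inr ⟨n, n.lt_succ_self, hz⟩⟩⟩
  obtain ⟨f, hf, hfg⟩ := exists_isometry_eqOn_of_dense hdense (g := g) (by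
    intro x hx z hz
    obtain ⟨m, hm⟩ := mem_iUnion.1 hx
    obtain ⟨n, hn⟩ := mem_iUnion.1 hz
    have hm' := enumerated_mono s y (le_max_left m n) hm
    have hn' := enumerated_mono s y (le_max_right m n) hn
    rw [hg _ hm', hg _ hn', (F (max m n)).2.dist_eq x hm' z hn'])
  have hfF : ∀ n, EqOn f (F n).1 (enumerated s y n) := fun n x hx =>
    (hfg (mem_iUnion.2 ⟨n, hx⟩)).trans (hg n hx)
  refine ⟨f, hf, fun z => (hfF 0 (Or.inl z.2)).trans ((F 0).2.extends_e z), fun n x hx => ?_⟩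
  -- Stage `n + 1` is the first that treats the index `n`.
  obtain ⟨p, hp, hpE⟩ := (F (n + 1)).2.eq_E n n.lt_succ_self x hx
  refine ⟨p, hp.trans (extensionSeq_congr (fun j hj z hz => ?_) x), ?_⟩
  · exact (hfF (n + 1) (Or.inr ⟨j, hj.trans n.lt_succ_self, hz⟩)).symm
  · exact (hfF (n + 1) (Or.inr ⟨n, n.lt_succ_self, hx⟩)).trans hpE

theorem BuiltFrom.eq (hs : MetricallyDenseSeq s) {f g : X → U} (hf : BuiltFrom E s y e f)
    (hg : BuiltFrom E s y e g) (hfc : Continuous f) (hgc : Continuous g) : f = g := by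
  have h : ∀ n x, s n = some x → f x = g x := by
    intro n
    induction n using Nat.strong_induction_on with
    | _ n ih =>
      intro x hx
      obtain ⟨p, hp, hfp⟩ := hf n x hx
      obtain ⟨q, hq, hgq⟩ := hg n x hx
      have hpq : p = q := Subtype.ext (by rw [hp, hq, extensionSeq_congr ih])
      rw [hfp, hgq, hpq]
  have hd : Dense {x | ∃ n, s n = some x} := by
    refine Metric.dense_iff.2 fun x r hr => ?_
    obtain ⟨n, z, hz, hxz⟩ := hs x r hr
    exact ⟨z, Metric.mem_ball'.2 hxz, n, hz⟩
  exact hfc.ext_on hd hgc fun x ⟨n, hn⟩ => h n x hn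

end Extension

end Urysohn

theorem theorem4p54 {D : Type*} [CommRing D] [LinearOrder D] [IsStrictOrderedRing D]
    [Archimedean D] [DenselyOrdered D] :
    -- an inhabited complete metrically separable metric space
    (Nonempty (Urysohn.UrysohnSpace D) ∧ CompleteSpace (Urysohn.UrysohnSpace D) ∧
      ∃ u : ℕ → Urysohn.UrysohnSpace D, DenseRange u) ∧
    -- a map realizing every permissible finite family of distances, and a canonical one
    (∃! E : Urysohn.PermissibleSeq (Urysohn.UrysohnSpace D) → Urysohn.UrysohnSpace D,
      Urysohn.Realizes E ∧ Urysohn.IsLimitOfTuples E) ∧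
    -- the canonical extension of finite partial isometries, for any choice of such a map
    (∀ E : Urysohn.PermissibleSeq (Urysohn.UrysohnSpace D) → Urysohn.UrysohnSpace D,
      Urysohn.Realizes E →
      ∀ (X : Type*) [MetricSpace X] (s : ℕ → Option X), Urysohn.MetricallyDenseSeq s →
      ∀ (k : ℕ) (y : Fin k → X) (e : Set.range y → Urysohn.UrysohnSpace D), Isometry e →
      ∃! f : X → Urysohn.UrysohnSpace D,
        Isometry f ∧ (∀ z : Set.range y, f z = e z) ∧ Urysohn.BuiltFrom E s y e f) := by
  have : Nonempty (Urysohn.UrysohnSpace D) :=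
    ⟨(Classical.arbitrary (Urysohn.PermissibleTuple D) : Urysohn.UrysohnSpace D)⟩
  refine ⟨⟨this, inferInstance, TopologicalSpace.exists_dense_seq _⟩, ?_, ?_⟩
  · obtain ⟨E, hE⟩ := Urysohn.exists_isLimitOfTuples (D := D)
    exact ⟨E, ⟨hE.realizes, hE⟩, fun E' hE' => hE'.2.eq hE⟩
  · intro E hE X _ s hs k y e he
    obtain ⟨f, hf, hfe, hfE⟩ := Urysohn.exists_builtFrom hE hs he
    exact ⟨f, ⟨hf, hfe, hfE⟩, fun g hg => hg.2.2.eq hs hfE hg.1.continuous hf.continuous⟩
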